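/- Let $\mathbb{T}\subseteq\mathbb{R}$ be a time scale (a nonempty closed set), let $a,b\in\mathbb{T}$ with $a<b$, let $B>0$, let $\varphi:\mathbb{R}\to\mathbb{R}$ be positive and continuous, and let $\alpha\in\mathbb{R}\setminus\{0,1\}$. Regard $[a,b]_{\mathbb{T}}=[a,b]\cap\mathbb{T}$ as a time scale with forward jump $\sigma$, backward jump $\rho$, graininess $\mu(t)=\sigma(t)-t$ and $\Delta$-derivative $y^\Delta$, and let $[a,b]^\kappa_{\mathbb{T}}$ be the set of its points that are non-maximal or left-dense ($\rho(t)=t$). A function is rd-continuous if it is continuous at right-dense points ($\sigma(t)=t$) and has finite left-sided limits at left-dense points; $C^1_{\mathrm{rd}}$ is the class of $\Delta$-differentiable functions with rd-continuous $\Delta$-derivative. The $\Delta$-integral is $\int_a^b f(t)\,\Delta t=H(b)-H(a)$, where $H$ is any antiderivative of $f$, that is, $H^\Delta(t)=f(t)$ for all $t\in[a,b]^\kappa_{\mathbb{T}}$; it exists when $f$ has an antiderivative. Call a $C^1_{\mathrm{rd}}$ function $y:[a,b]_{\mathbb{T}}\to\mathbb{R}$ admissible if $y^\Delta(t)>0$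 on $[a,b]^\kappa_{\mathbb{T}}$, $y(a)=0$ and $y(b)=B$, and consider the functional $$F[y]=\int_a^b\left[\left\{\int_0^1\varphi\bigl(y(t)+h\mu(t)y^\Delta(t)\bigr)\,dh\right\}y^\Delta(t)\right]^\alpha\Delta t$$ on the set $\mathcal{D}$ of all admissible $y$ for which this $\Delta$-integral exists. Let $G(x)=\int_0^x\varphi(s)\,ds$ for $x\ge 0$, let $G^{-1}$ be its inverse, and let $$C=\frac{G(B)}{b-a},\qquad y^*(t)=G^{-1}(C(t-a)),\quad t\in[a,b]_{\mathbb{T}}.$$ Then every admissible $y$ belongs to $\mathcal{D}$ if $\alpha>0$, and for every $\alpha$ every admissible $y$ whose integrand is rd-continuous belongs to $\mathcal{D}$. Moreover: (i) If $\alpha<0$ or $\alpha>1$, then $y^*\in\mathcal{D}$, $F$ attains its minimum over $\mathcal{D}$ at $y^*$ and only at $y^*$, and $F_{\min}=F[y^*]=(b-a)C^\alpha$. (ii) If $0<\alpha<1$, then $y^*\in\mathcal{D}$, $F$ attains its maximum over $\mathcal{D}$ at $y^*$ and only at $y^*$, and $F_{\max}=F[y^*]=(b-a)C^\alpha$. 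-/

import Mathlib

open Set Filter Topology

noncomputable section

namespace TimeScale

/-- A time scale is a nonempty closed subset of `ℝ`. -/
def IsTimeScale (T : Set ℝ) : Prop := T.Nonempty ∧ IsClosed T

/-- The interval `[a,b]_T`, which is itself a time scale when `a ≤ b` are points of `T`. -/
def interval (T : Set ℝ) (a b : ℝ) : Set ℝ := T ∩ Icc a b

open Classical in
/-- Forward jump operator `σ(t) = inf {s ∈ T : s > t}`, with `inf ∅ = sup T`. -/
def sigma (T : Set ℝ) (t : ℝ) : ℝ :=
  if (T ∩ Ioi t).Nonempty then sInf (T ∩ Ioi t) else sSup T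

open Classical in
/-- Backward jump operator `ρ(t) = sup {s ∈ T : s < t}`, with `sup ∅ = inf T`. -/
def rho (T : Set ℝ) (t : ℝ) : ℝ :=
  if (T ∩ Iio t).Nonempty then sSup (T ∩ Iio t) else sInf T

/-- Graininess `μ(t) = σ(t) - t`. -/
def graininess (T : Set ℝ) (t : ℝ) : ℝ := sigma T t - t

def RightDense (T : Set ℝ) (t : ℝ) : Prop := sigma T t = t

def LeftDense (T : Set ℝ) (t : ℝ) : Prop := rho T t = t

/-- `T^κ`: the points of `T` that are non-maximal or left-dense. -/
def kappa (T : Set ℝ) : Set ℝ := {t ∈ T | (∃ s ∈ T, t < s) ∨ LeftDense T t}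

/-- `f` is `Δ`-differentiable at `t` on the time scale `T`, with `Δ`-derivative `d`.
Only the values of `f` on `T` matter. -/
def HasDeltaDerivAt (T : Set ℝ) (f : ℝ → ℝ) (d t : ℝ) : Prop :=
  ∀ ε > 0, ∃ δ > 0, ∀ s ∈ T, |s - t| < δ →
    |f (sigma T t) - f s - d * (sigma T t - s)| ≤ ε * |sigma T t - s|

open Classical in
/-- The `Δ`-derivative `f^Δ(t)` (and `0` if `f` is not `Δ`-differentiable at `t`). -/
def deltaDeriv (T : Set ℝ) (f : ℝ → ℝ) (t : ℝ) : ℝ :=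
  if h : ∃ d, HasDeltaDerivAt T f d t then h.choose else 0

/-- Rd-continuity of a function on `T^κ`: it is continuous at the right-dense points and has
a finite left-sided limit at the left-dense points (density refers to `T`). -/
def RdContinuous (T : Set ℝ) (f : ℝ → ℝ) : Prop :=
  ∀ t ∈ kappa T,
    (RightDense T t → ContinuousWithinAt f (kappa T) t) ∧
    (LeftDense T t → ∃ l : ℝ, Tendsto f (𝓝[kappa T ∩ Iio t] t) (𝓝 l))

/-- `C¹_rd`: `Δ`-differentiable on `T^κ` with rd-continuous `Δ`-derivative. -/
def C1rd (T : Set ℝ) (f : ℝ → ℝ) : Prop :=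
  (∀ t ∈ kappa T, ∃ d, HasDeltaDerivAt T f d t) ∧ RdContinuous T (deltaDeriv T f)

/-- `F` is an antiderivative of `f`: `F^Δ(t) = f(t)` for all `t ∈ T^κ`. -/
def IsAntiderivative (T : Set ℝ) (F f : ℝ → ℝ) : Prop :=
  ∀ t ∈ kappa T, HasDeltaDerivAt T F (f t) t

/-- `f` has an antiderivative on `T`, so that its `Δ`-integrals are defined. -/
def DeltaIntegrable (T : Set ℝ) (f : ℝ → ℝ) : Prop := ∃ F, IsAntiderivative T F f

open Classical in
/-- The `Δ`-integral `∫_s^r f(t) Δt = F(r) - F(s)`, where `F` is an antiderivative of `f`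
(and `0` if there is none). -/
def deltaIntegral (T : Set ℝ) (f : ℝ → ℝ) (s r : ℝ) : ℝ :=
  if h : DeltaIntegrable T f then h.choose r - h.choose s else 0

/-- The integrand `[{∫₀¹ φ(y(t) + h μ(t) y^Δ(t)) dh} y^Δ(t)]^α` on the time scale `S`. -/
def integrand (S : Set ℝ) (φ : ℝ → ℝ) (α : ℝ) (y : ℝ → ℝ) (t : ℝ) : ℝ :=
  ((∫ h in (0 : ℝ)..1, φ (y t + h * graininess S t * deltaDeriv S y t))
    * deltaDeriv S y t) ^ α

/-- The functional `F[y] = ∫_a^b [{∫₀¹ φ(y + h μ y^Δ) dh} y^Δ]^α Δt` on `[a,b]_T`. -/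
def functional (T : Set ℝ) (a b : ℝ) (φ : ℝ → ℝ) (α : ℝ) (y : ℝ → ℝ) : ℝ :=
  deltaIntegral (interval T a b) (integrand (interval T a b) φ α y) a b

/-- The competitors: `C¹_rd` functions on `[a,b]_T` with `y^Δ > 0` on `[a,b]_T^κ`,
`y(a) = 0` and `y(b) = B`. -/
def Admissible (T : Set ℝ) (a b B : ℝ) (y : ℝ → ℝ) : Prop :=
  C1rd (interval T a b) y ∧
  (∀ t ∈ kappa (interval T a b), 0 < deltaDeriv (interval T a b) y t) ∧
  y a = 0 ∧ y b = B

/-- The admissible functions at which the functional is defined. -/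
def functionalDomain (T : Set ℝ) (a b B : ℝ) (φ : ℝ → ℝ) (α : ℝ) : Set (ℝ → ℝ) :=
  {y | Admissible T a b B y ∧
    DeltaIntegrable (interval T a b) (integrand (interval T a b) φ α y)}

/-- `G(x) = ∫₀ˣ φ(s) ds`. -/
def primitive (φ : ℝ → ℝ) (x : ℝ) : ℝ := ∫ s in (0 : ℝ)..x, φ s

/-- The inverse of `G` on `[0, ∞)`. -/
def primitiveInv (φ : ℝ → ℝ) : ℝ → ℝ := Function.invFunOn (primitive φ) (Ici 0)

/-- `C = (∫₀ᴮ φ(s) ds) / (b - a)`. -/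
def extremalConst (φ : ℝ → ℝ) (a b B : ℝ) : ℝ := (∫ s in (0 : ℝ)..B, φ s) / (b - a)

/-- The function `t ↦ G⁻¹(C (t - a))`. -/
def extremal (φ : ℝ → ℝ) (a b B : ℝ) (t : ℝ) : ℝ :=
  primitiveInv φ (extremalConst φ a b B * (t - a))

end TimeScale

end

namespace TimeScale

/-! Put `U = G ∘ y`. The mean of `φ` over the jump of `y` makes the chain rule exact
(`hasDeltaDerivAt_primitive_comp`): the bracket in the functional is `u = U^Δ`, so `F[y] = ∫ u^α
Δt`, while the boundary values force `∫ u Δt = G(B) = C (b - a)`. What remains is a Jensen problem: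
`u ↦ u^α` lies strictly on one side of its tangent at `C`, except at `C`, and the linear term of the
tangent integrates to zero. Equality forces `u = C`, hence `G (y t) = C (t - a)` and `y = y*`
(`integral_rpow_compare`, `functional_compare`).

As the Δ-integral is defined through antiderivatives, integral inequalities come from a mean value
theorem: a nonnegative Δ-derivative implies monotonicity (`monotoneOn_of_deltaDeriv_nonneg`).
Membership in the domain rests on the existence of antiderivatives of rd-continuous functions
(`deltaIntegrable_of_rdContinuous`). -/

/-- A compact time scale with minimum `a` and maximum `b`, where `a < b`. -/
structure IsCompactScale (S : Set ℝ) (a b : ℝ) : Prop where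
  closed : IsClosed S
  left_mem : a ∈ S
  right_mem : b ∈ S
  subset : S ⊆ Icc a b
  lt : a < b

theorem isCompactScale_interval {T : Set ℝ} (hT : IsTimeScale T) {a b : ℝ} (ha : a ∈ T)
    (hb : b ∈ T) (hab : a < b) : IsCompactScale (interval T a b) a b where
  closed := hT.2.inter isClosed_Icc
  left_mem := ⟨ha, left_mem_Icc.2 hab.le⟩
  right_mem := ⟨hb, right_mem_Icc.2 hab.le⟩
  subset := inter_subset_right
  lt := hab

variable {S : Set ℝ} {a b : ℝ}

theorem kappa_subset : kappa S ⊆ S := fun _ h => h.1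

/-! ### Jump operators, density and `S^κ` on a compact scale -/

namespace IsCompactScale

theorem isCompact (h : IsCompactScale S a b) : IsCompact S :=
  isCompact_Icc.of_isClosed_subset h.closed h.subset

theorem mem_kappa_of_lt (h : IsCompactScale S a b) {t : ℝ} (ht : t ∈ S) (htb : t < b) :
    t ∈ kappa S :=
  ⟨ht, Or.inl ⟨b, h.right_mem, htb⟩⟩

theorem lt_of_mem (h : IsCompactScale S a b) {t : ℝ} (ht : t ∈ S) (hne : t ≠ b) : t < b :=
  lt_of_le_of_ne (h.subset ht).2 hne

/-- The convention `inf ∅ = sup S` makes the maximum right-dense, so `b` needs separate care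
wherever right-density is used. -/
theorem sigma_right (h : IsCompactScale S a b) : sigma S b = b := by
  have hempty : ¬ (S ∩ Ioi b).Nonempty := by
    rintro ⟨x, hx, hbx⟩
    exact absurd (h.subset hx).2 (not_le.2 hbx)
  rw [sigma, if_neg hempty]
  exact IsGreatest.csSup_eq ⟨h.right_mem, fun x hx => (h.subset hx).2⟩

theorem sigma_eq_sInf (h : IsCompactScale S a b) {t : ℝ} (htb : t < b) :
    sigma S t = sInf (S ∩ Ioi t) := by
  rw [sigma, if_pos ⟨b, h.right_mem, htb⟩]

theorem sigma_le (h : IsCompactScale S a b) {t s : ℝ} (hs : s ∈ S) (hts : t < s) :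
    sigma S t ≤ s := by
  rw [h.sigma_eq_sInf (hts.trans_le (h.subset hs).2)]
  exact csInf_le ⟨t, fun x hx => hx.2.le⟩ ⟨hs, hts⟩

theorem le_sigma (h : IsCompactScale S a b) {t : ℝ} (ht : t ∈ S) : t ≤ sigma S t := by
  rcases (h.subset ht).2.eq_or_lt with rfl | htb
  · rw [h.sigma_right]
  · rw [h.sigma_eq_sInf htb]
    exact le_csInf ⟨b, h.right_mem, htb⟩ fun x hx => hx.2.le

theorem sigma_mem (h : IsCompactScale S a b) {t : ℝ} (ht : t ∈ S) : sigma S t ∈ S := by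
  rcases (h.subset ht).2.eq_or_lt with rfl | htb
  · rwa [h.sigma_right]
  · rw [h.sigma_eq_sInf htb]
    have hcl : sInf (S ∩ Ioi t) ∈ closure (S ∩ Ioi t) :=
      csInf_mem_closure ⟨b, h.right_mem, htb⟩ ⟨t, fun x hx => hx.2.le⟩
    exact h.closed.closure_subset_iff.2 inter_subset_left hcl

theorem lt_sigma (h : IsCompactScale S a b) {t : ℝ} (ht : t ∈ S) (hd : ¬ RightDense S t) :
    t < sigma S t :=
  lt_of_le_of_ne (h.le_sigma ht) (Ne.symm hd)

theorem graininess_nonneg (h : IsCompactScale S a b) {t : ℝ} (ht : t ∈ S) :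
    0 ≤ graininess S t :=
  sub_nonneg.2 (h.le_sigma ht)

theorem exists_mem_right (h : IsCompactScale S a b) {t : ℝ} (hd : RightDense S t)
    (htb : t < b) {u : ℝ} (hu : t < u) : ∃ s ∈ S, t < s ∧ s < u := by
  have hd' : sInf (S ∩ Ioi t) = t := (h.sigma_eq_sInf htb).symm.trans hd
  obtain ⟨s, hs, hsu⟩ := exists_lt_of_csInf_lt (s := S ∩ Ioi t) ⟨b, h.right_mem, htb⟩
    (hd'.symm ▸ hu)
  exact ⟨s, hs.1, hs.2, hsu⟩

theorem rho_eq_sSup (h : IsCompactScale S a b) {t : ℝ} (hat : a < t) :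
    rho S t = sSup (S ∩ Iio t) := by
  rw [rho, if_pos ⟨a, h.left_mem, hat⟩]

/-- The convention `sup ∅ = inf S` makes `a` left-dense with nothing to its left; hence the
condition `a < t`. -/
theorem exists_mem_left (h : IsCompactScale S a b) {t : ℝ} (hd : LeftDense S t)
    (hat : a < t) {u : ℝ} (hu : u < t) : ∃ s ∈ S, u < s ∧ s < t := by
  have hd' : sSup (S ∩ Iio t) = t := (h.rho_eq_sSup hat).symm.trans hd
  obtain ⟨s, hs, hsu⟩ := exists_lt_of_lt_csSup (s := S ∩ Iio t) ⟨a, h.left_mem, hat⟩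
    (hd'.symm ▸ hu)
  exact ⟨s, hs.1, hsu, hs.2⟩

theorem leftDense_of_forall (h : IsCompactScale S a b) {t : ℝ}
    (hd : ∀ u < t, ∃ s ∈ S, u < s ∧ s < t) : LeftDense S t := by
  obtain ⟨s, hs, -, hst⟩ := hd (t - 1) (by linarith)
  have hat : a < t := (h.subset hs).1.trans_lt hst
  rw [LeftDense, h.rho_eq_sSup hat]
  refine csSup_eq_of_forall_le_of_forall_lt_exists_gt ⟨s, hs, hst⟩ (fun x hx => hx.2.le) ?_
  intro w hw
  obtain ⟨r, hr, hwr, hrt⟩ := hd w hw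
  exact ⟨r, ⟨hr, hrt⟩, hwr⟩

theorem nhdsWithin_left_eq_bot (h : IsCompactScale S a b) {t : ℝ} (hd : ¬ LeftDense S t) :
    𝓝[S ∩ Iio t] t = ⊥ := by
  have : ¬ ∀ u < t, ∃ s ∈ S, u < s ∧ s < t := fun H => hd (h.leftDense_of_forall H)
  push Not at this
  obtain ⟨u, hu, H⟩ := this
  rw [← empty_mem_iff_bot]
  filter_upwards [self_mem_nhdsWithin, mem_nhdsWithin_of_mem_nhds (Ioi_mem_nhds hu)]
    with s hs hus
  exact absurd hs.2 (not_lt.2 (H s hs.1 hus))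

theorem nhdsWithin_right_eq_bot (h : IsCompactScale S a b) {t : ℝ} (ht : t ∈ S)
    (hd : ¬ RightDense S t) : 𝓝[S ∩ Ioi t] t = ⊥ := by
  rw [← empty_mem_iff_bot]
  filter_upwards [self_mem_nhdsWithin,
    mem_nhdsWithin_of_mem_nhds (Iio_mem_nhds (h.lt_sigma ht hd))] with s hs hus
  exact absurd (h.sigma_le hs.1 hs.2) (not_le.2 hus)

theorem mem_kappa_iff (h : IsCompactScale S a b) {t : ℝ} (ht : t ∈ S) :
    t ∈ kappa S ↔ t < b ∨ LeftDense S t := by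
  refine ⟨?_, ?_⟩
  · rintro ⟨-, ⟨s, hs, hts⟩ | hd⟩
    · exact Or.inl (hts.trans_le (h.subset hs).2)
    · exact Or.inr hd
  · rintro (htb | hd)
    · exact h.mem_kappa_of_lt ht htb
    · exact ⟨ht, Or.inr hd⟩

/-- Near a point of `S^κ` the sets `S` and `S^κ` agree. -/
theorem kappa_mem_nhdsWithin (h : IsCompactScale S a b) {t : ℝ} (ht : t ∈ kappa S) :
    kappa S ∈ 𝓝[S] t := by
  by_cases hb : b ∈ kappa S
  · filter_upwards [self_mem_nhdsWithin] with s hs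
    rcases eq_or_ne s b with rfl | hne
    · exact hb
    · exact h.mem_kappa_of_lt hs (h.lt_of_mem hs hne)
  · have htb : t < b := h.lt_of_mem ht.1 fun e => hb (e ▸ ht)
    filter_upwards [self_mem_nhdsWithin, mem_nhdsWithin_of_mem_nhds (Iio_mem_nhds htb)]
      with s hs hsb
    exact h.mem_kappa_of_lt hs hsb

theorem nhdsWithin_kappa (h : IsCompactScale S a b) {t : ℝ} (ht : t ∈ kappa S) :
    𝓝[kappa S] t = 𝓝[S] t :=
  le_antisymm (nhdsWithin_mono _ kappa_subset)
    (le_inf nhdsWithin_le_nhds (le_principal_iff.2 (h.kappa_mem_nhdsWithin ht)))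

theorem kappa_inter_Iio (h : IsCompactScale S a b) {t : ℝ} (ht : t ∈ S) :
    kappa S ∩ Iio t = S ∩ Iio t :=
  Subset.antisymm (inter_subset_inter_left _ kappa_subset) fun _ hs =>
    ⟨h.mem_kappa_of_lt hs.1 (lt_of_lt_of_le hs.2 (h.subset ht).2), hs.2⟩

/-- A point of `S^κ` is an accumulation point of `S` if it is right-dense. -/
theorem nhdsWithin_diff_neBot (h : IsCompactScale S a b) {t : ℝ} (ht : t ∈ kappa S)
    (hd : RightDense S t) : (𝓝[S \ {t}] t).NeBot := by
  rw [← mem_closure_iff_nhdsWithin_neBot, Metric.mem_closure_iff]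
  intro ε hε
  rcases (h.subset ht.1).2.eq_or_lt with rfl | htb
  · have hl : LeftDense S t := by
      rcases (h.mem_kappa_iff ht.1).1 ht with hlt | hl
      · exact absurd hlt (lt_irrefl _)
      · exact hl
    obtain ⟨s, hs, h1, h2⟩ := h.exists_mem_left hl h.lt (sub_lt_self t hε)
    refine ⟨s, ⟨hs, h2.ne⟩, ?_⟩
    rw [Real.dist_eq, abs_lt]; constructor <;> linarith
  · obtain ⟨s, hs, h1, h2⟩ := h.exists_mem_right hd htb (lt_add_of_pos_right t hε)
    refine ⟨s, ⟨hs, h1.ne'⟩, ?_⟩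
    rw [Real.dist_eq, abs_lt]; constructor <;> linarith

theorem tendsto_sigma_of_rightDense (h : IsCompactScale S a b) {t : ℝ} (ht : t ∈ S)
    (hd : RightDense S t) : Tendsto (sigma S) (𝓝[S] t) (𝓝 t) := by
  rw [Metric.tendsto_nhdsWithin_nhds]
  intro ε hε
  rcases (h.subset ht).2.eq_or_lt with rfl | htb
  · refine ⟨ε, hε, fun {s} hs hst => ?_⟩
    rw [Real.dist_eq, abs_lt] at hst ⊢
    have h1 := h.le_sigma hs
    have h2 := (h.subset (h.sigma_mem hs)).2
    constructor <;> linarith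
  · obtain ⟨r, hr, h1, h2⟩ := h.exists_mem_right hd htb (lt_add_of_pos_right t hε)
    refine ⟨min ε (r - t), lt_min hε (by linarith), fun {s} hs hst => ?_⟩
    rw [Real.dist_eq, lt_min_iff, abs_lt, abs_lt] at hst
    rw [Real.dist_eq, abs_lt]
    have h3 := h.le_sigma hs
    have h4 := h.sigma_le hr (t := s) (by linarith [hst.2.2])
    constructor <;> linarith

theorem tendsto_sigma_left (h : IsCompactScale S a b) {t : ℝ} (ht : t ∈ S) :
    Tendsto (sigma S) (𝓝[S ∩ Iio t] t) (𝓝 t) := by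
  refine tendsto_of_tendsto_of_tendsto_of_le_of_le' (tendsto_nhdsWithin_of_tendsto_nhds tendsto_id)
    tendsto_const_nhds ?_ ?_
  · filter_upwards [self_mem_nhdsWithin] with s hs using h.le_sigma hs.1
  · filter_upwards [self_mem_nhdsWithin] with s hs using h.sigma_le ht hs.2

/-- Right-scattered points are isolated from the right in `S`, and a set of reals has only countably
many such points. -/
theorem countable_not_rightDense (h : IsCompactScale S a b) :
    {t ∈ S | ¬ RightDense S t}.Countable :=
  (countable_setOfPred_isolated_right_within (s := S)).mono fun _ ht => by
    exact ⟨ht.1, h.nhdsWithin_right_eq_bot ht.1 ht.2⟩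

end IsCompactScale

/-! ### The delta derivative -/

theorem hasDeltaDerivAt_iff_of_rightDense {f : ℝ → ℝ} {d t : ℝ} (hd : RightDense S t) :
    HasDeltaDerivAt S f d t ↔ HasDerivWithinAt f d S t := by
  have hd' : sigma S t = t := hd
  rw [hasDerivWithinAt_iff_isLittleO, Asymptotics.isLittleO_iff]
  constructor
  · intro H ε hε
    obtain ⟨δ, hδ, H⟩ := H ε hε
    rw [eventually_nhdsWithin_iff]
    filter_upwards [Metric.ball_mem_nhds t hδ] with s hs hsS
    have := H s hsS hs
    rw [hd'] at this
    rw [Real.norm_eq_abs, Real.norm_eq_abs, smul_eq_mul, abs_sub_comm s t,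
      ← abs_neg (f s - _ - _)]
    convert this using 2
    ring
  · intro H ε hε
    have := H hε
    rw [eventually_nhdsWithin_iff, Metric.eventually_nhds_iff] at this
    obtain ⟨δ, hδ, H⟩ := this
    refine ⟨δ, hδ, fun s hsS hs => ?_⟩
    have := H hs hsS
    rw [Real.norm_eq_abs, Real.norm_eq_abs, smul_eq_mul, abs_sub_comm s t,
      ← abs_neg (f s - _ - _)] at this
    rw [hd']
    convert this using 2
    ring

/-- Take `s = t` in the definition and let `ε` tend to `0`. -/
theorem HasDeltaDerivAt.sigma_eq {f : ℝ → ℝ} {d t : ℝ} (ht : t ∈ S)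
    (hf : HasDeltaDerivAt S f d t) : f (sigma S t) = f t + graininess S t * d := by
  have key : ∀ ε > 0, |f (sigma S t) - f t - d * (sigma S t - t)| ≤ ε * |sigma S t - t| := by
    intro ε hε
    obtain ⟨δ, hδ, H⟩ := hf ε hε
    exact H t ht (by simpa using hδ)
  have hz : |f (sigma S t) - f t - d * (sigma S t - t)| ≤ 0 := by
    refine ge_of_tendsto (x := 𝓝[>] (0 : ℝ)) (f := fun ε : ℝ => ε * |sigma S t - t|) ?_ ?_
    · have : Tendsto (fun ε : ℝ => ε * |sigma S t - t|) (𝓝 0) (𝓝 (0 * |sigma S t - t|)) :=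
        tendsto_id.mul_const _
      rw [zero_mul] at this
      exact tendsto_nhdsWithin_of_tendsto_nhds this
    · filter_upwards [self_mem_nhdsWithin] with ε hε using key ε hε
  have := abs_nonpos_iff.1 hz
  rw [graininess]
  linarith

theorem HasDeltaDerivAt.continuousWithinAt {f : ℝ → ℝ} {d t : ℝ} (ht : t ∈ S)
    (hf : HasDeltaDerivAt S f d t) : ContinuousWithinAt f S t := by
  have hσ := hf.sigma_eq ht
  rw [graininess] at hσ
  rw [Metric.continuousWithinAt_iff]
  intro ε hε
  set M := |sigma S t - t| + 1 with hM
  have hM0 : 0 < M := by positivity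
  obtain ⟨δ, hδ, H⟩ := hf (ε / (2 * M)) (by positivity)
  refine ⟨min (min δ 1) (ε / (2 * (|d| + 1))), by positivity, fun {s} hs hst => ?_⟩
  rw [Real.dist_eq, lt_min_iff, lt_min_iff] at hst
  obtain ⟨⟨h1, h2⟩, h3⟩ := hst
  have h4 := H s hs h1
  have h5 : |sigma S t - s| ≤ M := by
    calc |sigma S t - s| = |(sigma S t - t) + (t - s)| := by ring_nf
      _ ≤ |sigma S t - t| + |t - s| := abs_add_le _ _
      _ ≤ M := by rw [abs_sub_comm t s]; linarith
  have h6 : ε / (2 * M) * |sigma S t - s| ≤ ε / 2 := by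
    calc ε / (2 * M) * |sigma S t - s| ≤ ε / (2 * M) * M := by gcongr
      _ = ε / 2 := by field_simp
  have h7 : |d * (s - t)| < ε / 2 := by
    rw [abs_mul]
    calc |d| * |s - t| ≤ (|d| + 1) * |s - t| := by gcongr; linarith
      _ < (|d| + 1) * (ε / (2 * (|d| + 1))) := by gcongr
      _ = ε / 2 := by field_simp
  rw [Real.dist_eq]
  calc |f s - f t|
      = |-(f (sigma S t) - f s - d * (sigma S t - s)) + d * (s - t)| := by rw [hσ]; ring_nf
    _ ≤ |-(f (sigma S t) - f s - d * (sigma S t - s))| + |d * (s - t)| := abs_add_le _ _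
    _ < ε := by rw [abs_neg]; linarith

/-- Near a right-scattered `t` the factor `|σ(t) - s|` stays above `μ(t) / 2`, whereas the error
term is continuous in `s` and vanishes at `s = t`. -/
theorem IsCompactScale.hasDeltaDerivAt_of_not_rightDense (h : IsCompactScale S a b) {f : ℝ → ℝ}
    {d t : ℝ} (ht : t ∈ S) (hd : ¬ RightDense S t) (hc : ContinuousWithinAt f S t)
    (hσ : f (sigma S t) = f t + graininess S t * d) : HasDeltaDerivAt S f d t := by
  have hpos := sub_pos.2 (h.lt_sigma ht hd)
  rw [graininess] at hσ
  intro ε hε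
  have hc' : ContinuousWithinAt (fun s => f (sigma S t) - f s - d * (sigma S t - s)) S t :=
    (continuousWithinAt_const.sub hc).sub
      (continuousWithinAt_const.mul (continuousWithinAt_const.sub continuousWithinAt_id))
  obtain ⟨δ, hδ, H⟩ := Metric.continuousWithinAt_iff.1 hc' (ε * ((sigma S t - t) / 2))
    (by positivity)
  refine ⟨min δ ((sigma S t - t) / 2), lt_min hδ (by linarith), fun s hs hst => ?_⟩
  rw [lt_min_iff] at hst
  have h1 := H hs hst.1
  have h2 : f (sigma S t) - f t - d * (sigma S t - t) = 0 := by rw [hσ]; ring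
  rw [h2, Real.dist_eq, sub_zero] at h1
  have h3 : (sigma S t - t) / 2 ≤ |sigma S t - s| := by
    have := (abs_lt.1 hst.2).2
    exact le_trans (by linarith) (le_abs_self _)
  calc _ ≤ ε * ((sigma S t - t) / 2) := h1.le
    _ ≤ _ := by gcongr

theorem IsCompactScale.hasDeltaDerivAt_unique (h : IsCompactScale S a b) {f : ℝ → ℝ}
    {d d' t : ℝ} (ht : t ∈ kappa S) (hf : HasDeltaDerivAt S f d t)
    (hf' : HasDeltaDerivAt S f d' t) : d = d' := by
  by_cases hd : RightDense S t
  · rw [hasDeltaDerivAt_iff_of_rightDense hd] at hf hf'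
    have hu : UniqueDiffWithinAt ℝ S t := by
      have := h.nhdsWithin_diff_neBot ht hd
      exact uniqueDiffWithinAt_iff_accPt.2 (accPt_principal_iff_nhdsWithin.2 this)
    exact hu.eq_deriv _ hf hf'
  · have h1 := hf.sigma_eq ht.1
    have h2 := hf'.sigma_eq ht.1
    have hpos : graininess S t ≠ 0 := (sub_pos.2 (h.lt_sigma ht.1 hd)).ne'
    exact mul_left_cancel₀ hpos (by linarith)

theorem IsCompactScale.deltaDeriv_eq (h : IsCompactScale S a b) {f : ℝ → ℝ} {d t : ℝ}
    (ht : t ∈ kappa S) (hf : HasDeltaDerivAt S f d t) : deltaDeriv S f t = d := by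
  have hex : ∃ d, HasDeltaDerivAt S f d t := ⟨d, hf⟩
  rw [deltaDeriv, dif_pos hex]
  exact h.hasDeltaDerivAt_unique ht hex.choose_spec hf

theorem hasDeltaDerivAt_deltaDeriv {f : ℝ → ℝ} {t : ℝ} (hf : ∃ d, HasDeltaDerivAt S f d t) :
    HasDeltaDerivAt S f (deltaDeriv S f t) t := by
  rw [deltaDeriv, dif_pos hf]
  exact hf.choose_spec

theorem hasDeltaDerivAt_linear (c e t : ℝ) : HasDeltaDerivAt S (fun s => c * s + e) c t := by
  intro ε hε
  refine ⟨1, one_pos, fun s _ _ => ?_⟩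
  have : c * sigma S t + e - (c * s + e) - c * (sigma S t - s) = 0 := by ring
  simp only [this, abs_zero]
  positivity

theorem HasDeltaDerivAt.add {f g : ℝ → ℝ} {d e t : ℝ} (hf : HasDeltaDerivAt S f d t)
    (hg : HasDeltaDerivAt S g e t) : HasDeltaDerivAt S (fun s => f s + g s) (d + e) t := by
  intro ε hε
  obtain ⟨δ, hδ, H⟩ := hf (ε / 2) (by positivity)
  obtain ⟨δ', hδ', H'⟩ := hg (ε / 2) (by positivity)
  refine ⟨min δ δ', lt_min hδ hδ', fun s hs hst => ?_⟩
  rw [lt_min_iff] at hst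
  calc |f (sigma S t) + g (sigma S t) - (f s + g s) - (d + e) * (sigma S t - s)|
      = |(f (sigma S t) - f s - d * (sigma S t - s))
          + (g (sigma S t) - g s - e * (sigma S t - s))| := by ring_nf
    _ ≤ _ := abs_add_le _ _
    _ ≤ ε / 2 * |sigma S t - s| + ε / 2 * |sigma S t - s| :=
        add_le_add (H s hs hst.1) (H' s hs hst.2)
    _ = ε * |sigma S t - s| := by ring

theorem HasDeltaDerivAt.const_mul {f : ℝ → ℝ} {d t : ℝ} (c : ℝ)
    (hf : HasDeltaDerivAt S f d t) : HasDeltaDerivAt S (fun s => c * f s) (c * d) t := by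
  intro ε hε
  obtain ⟨δ, hδ, H⟩ := hf (ε / (|c| + 1)) (by positivity)
  refine ⟨δ, hδ, fun s hs hst => ?_⟩
  calc |c * f (sigma S t) - c * f s - c * d * (sigma S t - s)|
      = |c| * |f (sigma S t) - f s - d * (sigma S t - s)| := by rw [← abs_mul]; ring_nf
    _ ≤ (|c| + 1) * (ε / (|c| + 1) * |sigma S t - s|) := by
        gcongr
        · linarith
        · exact H s hs hst
    _ = ε * |sigma S t - s| := by field_simp

/-- A point of `S` outside `S^κ` is a left-scattered maximum, hence isolated, so continuity there is
automatic. -/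
theorem IsCompactScale.continuousOn_of_hasDeltaDerivAt (h : IsCompactScale S a b) {f : ℝ → ℝ}
    (hf : ∀ t ∈ kappa S, ∃ d, HasDeltaDerivAt S f d t) : ContinuousOn f S := by
  intro t ht
  by_cases hk : t ∈ kappa S
  · obtain ⟨d, hd⟩ := hf t hk
    exact hd.continuousWithinAt ht
  · have hl : ¬ LeftDense S t := fun H => hk ⟨ht, Or.inr H⟩
    have hsub : S ⊆ insert t (S ∩ Iio t) := by
      intro s hs
      rcases lt_trichotomy s t with hst | rfl | hst
      · exact Or.inr ⟨hs, hst⟩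
      · exact Or.inl rfl
      · exact absurd ⟨ht, Or.inl ⟨s, hs, hst⟩⟩ hk
    refine ContinuousWithinAt.mono (continuousWithinAt_insert_self.2 ?_) hsub
    rw [ContinuousWithinAt, h.nhdsWithin_left_eq_bot hl]
    exact tendsto_bot

/-! ### Monotonicity and uniqueness of antiderivatives -/

/-- Induction along the scale: at the infimum `c` of the failures the estimate still holds, and it
then persists to the right of `c`. The slack `ε` absorbs the error in the Δ-derivative at
right-dense points. -/
theorem IsCompactScale.le_add_of_deltaDeriv_nonneg (h : IsCompactScale S a b) {K k : ℝ → ℝ}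
    (hK : IsAntiderivative S K k) (hk : ∀ t ∈ kappa S, 0 ≤ k t) {r s : ℝ} (hr : r ∈ S)
    (hs : s ∈ S) (hrs : r ≤ s) {ε : ℝ} (hε : 0 < ε) : K r ≤ K s + ε * (s - r) := by
  have hcont := h.continuousOn_of_hasDeltaDerivAt fun t ht => ⟨_, hK t ht⟩
  by_contra hcon
  -- the infimum of the points where the estimate fails
  set A : Set ℝ := {x ∈ S | r ≤ x ∧ K x + ε * (x - r) < K r} with hA
  have hAne : A.Nonempty := ⟨s, hs, hrs, not_le.1 hcon⟩
  have hAb : BddBelow A := ⟨r, fun x hx => hx.2.1⟩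
  set c := sInf A with hc
  have hrc : r ≤ c := le_csInf hAne fun x hx => hx.2.1
  have hcS : c ∈ S :=
    h.closed.closure_subset_iff.2 (fun x hx => hx.1) (csInf_mem_closure hAne hAb)
  have hbelow : ∀ x ∈ S, r ≤ x → x < c → K r ≤ K x + ε * (x - r) := by
    intro x hx hrx hxc
    by_contra hlt
    exact absurd (csInf_le hAb ⟨hx, hrx, not_le.1 hlt⟩) (not_le.2 hxc)
  have hcP : K r ≤ K c + ε * (c - r) := by
    rcases hrc.eq_or_lt with heq | hlt
    · rw [← heq]; simp
    have hac : a < c := (h.subset hr).1.trans_lt hlt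
    by_cases hl : LeftDense S c
    · have hcl : c ∈ closure (S ∩ Ioo r c) := by
        rw [Metric.mem_closure_iff]
        intro η hη
        obtain ⟨x, hx, h1, h2⟩ := h.exists_mem_left hl hac
          (u := max r (c - η)) (max_lt hlt (by linarith))
        rw [max_lt_iff] at h1
        refine ⟨x, ⟨hx, h1.1, h2⟩, ?_⟩
        rw [Real.dist_eq, abs_lt]; constructor <;> linarith
      have hne : (𝓝[S ∩ Ioo r c] c).NeBot := mem_closure_iff_nhdsWithin_neBot.1 hcl
      have ht : Tendsto (fun x => K x + ε * (x - r)) (𝓝[S ∩ Ioo r c] c)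
          (𝓝 (K c + ε * (c - r))) := by
        refine ((hcont c hcS).mono inter_subset_left).tendsto.add ?_
        exact tendsto_nhdsWithin_of_tendsto_nhds (Continuous.tendsto (by fun_prop) c)
      refine ge_of_tendsto ht ?_
      filter_upwards [self_mem_nhdsWithin] with x hx using hbelow x hx.1 hx.2.1.le hx.2.2
    · -- the left neighbour of `c`
      set p := sSup (S ∩ Iio c) with hp
      have hne : (S ∩ Iio c).Nonempty := ⟨r, hr, hlt⟩
      have hbd : BddAbove (S ∩ Iio c) := ⟨c, fun x hx => hx.2.le⟩
      have hpS : p ∈ S :=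
        h.closed.closure_subset_iff.2 inter_subset_left (csSup_mem_closure hne hbd)
      have hpc : p < c := by
        refine lt_of_le_of_ne (csSup_le hne fun x hx => hx.2.le) ?_
        intro he
        exact hl ((h.rho_eq_sSup hac).trans he)
      have hrp : r ≤ p := le_csSup hbd ⟨hr, hlt⟩
      -- Otherwise `σ(p) ≤ p`, so `p` is right-dense and `S` has points strictly between `p` and
      -- `c`.
      have hσ : sigma S p = c := by
        refine le_antisymm (h.sigma_le hcS hpc) ?_
        by_contra hlt'
        rw [not_le] at hlt'
        have h1 : sigma S p ≤ p := le_csSup hbd ⟨h.sigma_mem hpS, hlt'⟩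
        have h2 : RightDense S p := le_antisymm h1 (h.le_sigma hpS)
        obtain ⟨x, hx, h3, h4⟩ := h.exists_mem_right h2
          (hpc.trans_le (h.subset hcS).2) hpc
        exact absurd (le_csSup hbd ⟨hx, h4⟩) (not_le.2 h3)
      have hpk := h.mem_kappa_of_lt hpS (hpc.trans_le (h.subset hcS).2)
      have h1 := (hK p hpk).sigma_eq hpS
      rw [hσ] at h1
      have h2 := mul_nonneg (h.graininess_nonneg hpS) (hk p hpk)
      have h3 := hbelow p hpS hrp hpc
      have h4 : ε * (p - r) ≤ ε * (c - r) := by gcongr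
      linarith
  have hcb : c < b := by
    refine h.lt_of_mem hcS fun hcb => ?_
    have hsc : s = c :=
      le_antisymm (hcb ▸ (h.subset hs).2) (csInf_le hAb ⟨hs, hrs, not_le.1 hcon⟩)
    exact hcon (hsc ▸ hcP)
  have hck := h.mem_kappa_of_lt hcS hcb
  have hKc := hK c hck
  -- At a right-dense `c` the slopes to the right are at least `-ε`; at a right-scattered `c` there
  -- is no point before `σ(c)`.
  have hnear : ∃ δ > 0, ∀ x ∈ S, c < x → x < c + δ → K r ≤ K x + ε * (x - r) := by
    by_cases hd : RightDense S c
    · obtain ⟨δ, hδ, H⟩ := hKc ε hε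
      refine ⟨δ, hδ, fun x hx h1 h2 => ?_⟩
      have h3 := H x hx (by rw [abs_lt]; constructor <;> linarith)
      rw [show sigma S c = c from hd, abs_sub_comm c x, abs_of_pos (sub_pos.2 h1)] at h3
      have h4 := (abs_le.1 h3).2
      have h5 := mul_nonneg (hk c hck) (sub_pos.2 h1).le
      nlinarith
    · refine ⟨sigma S c - c, sub_pos.2 (h.lt_sigma hcS hd), fun x hx h1 h2 => ?_⟩
      exact absurd (h.sigma_le hx h1) (by linarith)
  obtain ⟨δ, hδ, H⟩ := hnear
  obtain ⟨x, hx, hxδ⟩ := exists_lt_of_csInf_lt hAne (show sInf A < c + δ by linarith)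
  rcases (csInf_le hAb hx).eq_or_lt with heq | hlt
  · have : x = c := heq.symm
    exact absurd hx.2.2 (not_lt.2 (this ▸ hcP))
  · exact absurd hx.2.2 (not_lt.2 (H x hx.1 hlt hxδ))

theorem IsCompactScale.monotoneOn_of_deltaDeriv_nonneg (h : IsCompactScale S a b) {K k : ℝ → ℝ}
    (hK : IsAntiderivative S K k) (hk : ∀ t ∈ kappa S, 0 ≤ k t) : MonotoneOn K S := by
  intro r hr s hs hrs
  refine le_of_forall_pos_le_add fun η hη => ?_
  have hpos : 0 < s - r + 1 := by linarith
  have := h.le_add_of_deltaDeriv_nonneg hK hk hr hs hrs (div_pos hη hpos)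
  have h2 : η / (s - r + 1) * (s - r) ≤ η := by
    rw [div_mul_eq_mul_div, div_le_iff₀ hpos]; nlinarith
  linarith

/-- Both `F - G` and `G - F` are monotone. This makes the integral independent of the chosen
antiderivative. -/
theorem IsCompactScale.sub_eq_of_isAntiderivative (h : IsCompactScale S a b) {F G f g : ℝ → ℝ}
    (hF : IsAntiderivative S F f) (hG : IsAntiderivative S G g)
    (hfg : ∀ t ∈ kappa S, f t = g t) {r s : ℝ} (hr : r ∈ S) (hs : s ∈ S) :
    F s - F r = G s - G r := by
  wlog hrs : r ≤ s generalizing r s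
  · have := this hs hr (not_le.1 hrs).le
    linarith
  have key : ∀ {F G f g : ℝ → ℝ}, IsAntiderivative S F f → IsAntiderivative S G g →
      (∀ t ∈ kappa S, f t = g t) → F r - G r ≤ F s - G s := by
    intro F G f g hF hG hfg
    have := h.monotoneOn_of_deltaDeriv_nonneg
      (fun t ht => (hF t ht).add ((hG t ht).const_mul (-1)))
      (fun t ht => by simp [hfg t ht]) hr hs hrs
    simp only at this
    linarith
  have h1 := key hF hG hfg
  have h2 := key hG hF fun t ht => (hfg t ht).symm
  linarith

theorem IsCompactScale.deltaIntegral_eq (h : IsCompactScale S a b) {F f : ℝ → ℝ}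
    (hF : IsAntiderivative S F f) {r s : ℝ} (hr : r ∈ S) (hs : s ∈ S) :
    deltaIntegral S f r s = F s - F r := by
  have hex : DeltaIntegrable S f := ⟨F, hF⟩
  rw [deltaIntegral, dif_pos hex]
  exact h.sub_eq_of_isAntiderivative hex.choose_spec hF (fun _ _ => rfl) hr hs

/-! ### Antiderivatives of rd-continuous functions -/

/-- Each point has a bound on its left, at itself and on its right; compactness of `S` makes the
bound global. -/
theorem RdContinuous.exists_abs_le (h : IsCompactScale S a b) {f : ℝ → ℝ}
    (hf : RdContinuous S f) : ∃ M, 0 ≤ M ∧ ∀ t ∈ kappa S, |f t| ≤ M := by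
  have loc : ∀ t ∈ S, ∃ M, ∀ᶠ s in 𝓝[S] t, s ∈ kappa S → |f s| ≤ M := by
    intro t ht
    have left : ∃ M, ∀ᶠ s in 𝓝[S ∩ Iio t] t, |f s| ≤ M := by
      by_cases hl : LeftDense S t
      · obtain ⟨l, hl'⟩ := (hf t ⟨ht, Or.inr hl⟩).2 hl
        rw [h.kappa_inter_Iio ht] at hl'
        refine ⟨|l| + 1, ?_⟩
        filter_upwards [hl'.abs.eventually (gt_mem_nhds (lt_add_one |l|))] with s hs using hs.le
      · exact ⟨0, by rw [h.nhdsWithin_left_eq_bot hl]; exact eventually_bot⟩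
    have right : ∃ M, ∀ᶠ s in 𝓝[S ∩ Ioi t] t, |f s| ≤ M := by
      by_cases hd : RightDense S t
      · by_cases hk : t ∈ kappa S
        · have hc := (hf t hk).1 hd
          rw [ContinuousWithinAt, h.nhdsWithin_kappa hk] at hc
          refine ⟨|f t| + 1, ?_⟩
          filter_upwards [nhdsWithin_mono t inter_subset_left
            (hc.abs.eventually (gt_mem_nhds (lt_add_one |f t|)))] with s hs using hs.le
        · refine ⟨0, ?_⟩
          filter_upwards [self_mem_nhdsWithin] with s hs
          exact absurd ⟨ht, Or.inl ⟨s, hs.1, hs.2⟩⟩ hk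
      · exact ⟨0, by rw [h.nhdsWithin_right_eq_bot ht hd]; exact eventually_bot⟩
    obtain ⟨M₁, h₁⟩ := left
    obtain ⟨M₂, h₂⟩ := right
    refine ⟨max |f t| (max M₁ M₂), ?_⟩
    rw [eventually_nhdsWithin_iff] at h₁ h₂ ⊢
    filter_upwards [h₁, h₂] with s hs₁ hs₂ hs _
    rcases lt_trichotomy s t with hst | rfl | hst
    · exact (hs₁ ⟨hs, hst⟩).trans ((le_max_left _ _).trans (le_max_right _ _))
    · exact le_max_left _ _
    · exact (hs₂ ⟨hs, hst⟩).trans ((le_max_right _ _).trans (le_max_right _ _))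
  obtain ⟨M, hM⟩ : ∃ M, ∀ t ∈ S, t ∈ kappa S → |f t| ≤ M := by
    refine h.isCompact.induction_on (p := fun A => ∃ M, ∀ t ∈ A, t ∈ kappa S → |f t| ≤ M)
      ⟨0, by simp⟩ ?_ ?_ ?_
    · rintro A A' hA ⟨M, hM⟩
      exact ⟨M, fun t ht => hM t (hA ht)⟩
    · rintro A A' ⟨M, hM⟩ ⟨M', hM'⟩
      refine ⟨max M M', fun t ht hk => ?_⟩
      rcases ht with ht | ht
      · exact (hM t ht hk).trans (le_max_left _ _)
      · exact (hM' t ht hk).trans (le_max_right _ _)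
    · intro t ht
      obtain ⟨M, hM⟩ := loc t ht
      exact ⟨_, hM, M, fun s hs => hs⟩
  exact ⟨max M 0, le_max_right _ _, fun t ht => (hM t ht.1 ht).trans (le_max_left _ _)⟩

/-- The last point of `S` before `x`, for `x ≥ a`. -/
noncomputable def lastBefore (S : Set ℝ) (a x : ℝ) : ℝ := sSup (S ∩ Iic (max x a))

namespace IsCompactScale

theorem bddAbove_inter_Iic (_ : IsCompactScale S a b) (x : ℝ) : BddAbove (S ∩ Iic x) :=
  ⟨x, fun _ hy => hy.2⟩

theorem monotone_lastBefore (h : IsCompactScale S a b) : Monotone (lastBefore S a) := by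
  intro x y hxy
  refine csSup_le_csSup (h.bddAbove_inter_Iic _) ⟨a, h.left_mem, mem_Iic.2 (le_max_right _ _)⟩ ?_
  exact inter_subset_inter_right _ (Iic_subset_Iic.2 (max_le_max_right _ hxy))

theorem lastBefore_mem (h : IsCompactScale S a b) (x : ℝ) : lastBefore S a x ∈ S :=
  h.closed.closure_subset_iff.2 inter_subset_left
    (csSup_mem_closure ⟨a, h.left_mem, mem_Iic.2 (le_max_right _ _)⟩ (h.bddAbove_inter_Iic _))

theorem lastBefore_le (h : IsCompactScale S a b) {x : ℝ} (hx : a ≤ x) :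
    lastBefore S a x ≤ x := by
  rw [lastBefore, max_eq_left hx]
  exact csSup_le ⟨a, h.left_mem, hx⟩ fun y hy => hy.2

theorem le_lastBefore (h : IsCompactScale S a b) {t x : ℝ} (ht : t ∈ S) (hx : t ≤ x) :
    t ≤ lastBefore S a x :=
  le_csSup (h.bddAbove_inter_Iic _) ⟨ht, hx.trans (le_max_left _ _)⟩

theorem lastBefore_eq (h : IsCompactScale S a b) {t x : ℝ} (ht : t ∈ S) (hx : t ≤ x)
    (hσ : x < sigma S t) : lastBefore S a x = t := by
  refine le_antisymm ?_ (h.le_lastBefore ht hx)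
  by_contra hlt
  have h1 := h.sigma_le (h.lastBefore_mem x) (not_le.1 hlt)
  have h2 := h.lastBefore_le ((h.subset ht).1.trans hx)
  linarith

/-- Off the countable set of right-scattered points and `b`, `f` is continuous on `S`; altering a
measurable function on a countable set keeps it measurable. The point `b` is removed because it is
right-dense but may lie outside `S^κ`. -/
theorem measurable_indicator_kappa (h : IsCompactScale S a b) {f : ℝ → ℝ}
    (hf : RdContinuous S f) : Measurable ((kappa S).indicator f) := by
  classical
  have hcount : {t ∈ S | ¬ RightDense S t}.Countable := h.countable_not_rightDense
  have hms : MeasurableSet (S \ ({t ∈ S | ¬ RightDense S t} ∪ {b})) :=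
    h.closed.measurableSet.diff (hcount.union (countable_singleton b)).measurableSet
  have hcont : ContinuousOn f (S \ ({t ∈ S | ¬ RightDense S t} ∪ {b})) := by
    rintro t ⟨ht, hnt⟩
    rw [mem_union, not_or] at hnt
    have hk : t ∈ kappa S := h.mem_kappa_of_lt ht (h.lt_of_mem ht hnt.2)
    have hd : RightDense S t := by
      by_contra hd
      exact hnt.1 ⟨ht, hd⟩
    have := (hf t hk).1 hd
    rw [ContinuousWithinAt, h.nhdsWithin_kappa hk] at this
    exact this.mono_left (nhdsWithin_mono _ sdiff_subset)
  have hm := hcont.measurable_piecewise (g := fun _ => 0) continuousOn_const hms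
  refine hm.measurable_of_countable_ne ((hcount.union (countable_singleton b)).mono ?_)
  intro t ht
  by_contra hnt
  refine ht ?_
  by_cases htS : t ∈ S
  · have hk : t ∈ kappa S := by
      rw [mem_union, not_or] at hnt
      exact h.mem_kappa_of_lt htS (h.lt_of_mem htS hnt.2)
    rw [piecewise_eq_of_mem _ _ _ (mem_sdiff_of_mem htS hnt), indicator_of_mem hk]
  · rw [piecewise_eq_of_notMem _ _ _ fun H => htS H.1,
      indicator_of_notMem fun H => htS (kappa_subset H)]

/-- Extend `f` across each gap `[t, σ(t))` by the constant `f t`. The Lebesgue primitive of this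
extension is an antiderivative: its increment over a gap is `μ(t) f(t)`, and at right-dense points
continuity of `f` gives the derivative. -/
theorem deltaIntegrable_of_rdContinuous (h : IsCompactScale S a b) {f : ℝ → ℝ}
    (hf : RdContinuous S f) : DeltaIntegrable S f := by
  obtain ⟨M, hM0, hM⟩ := hf.exists_abs_le h
  set g : ℝ → ℝ := fun x => (kappa S).indicator f (lastBefore S a x) with hg
  have hgm : Measurable g := (h.measurable_indicator_kappa hf).comp h.monotone_lastBefore.measurable
  have hgb : ∀ x, ‖g x‖ ≤ M := by
    intro x
    by_cases hx : lastBefore S a x ∈ kappa S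
    · simpa [hg, hx] using hM _ hx
    · simpa [hg, hx] using hM0
  have hgi : ∀ x y, IntervalIntegrable g MeasureTheory.volume x y := fun x y =>
    (intervalIntegrable_const (c := M)).mono_fun hgm.aestronglyMeasurable
      (Eventually.of_forall fun z => by
        rw [Real.norm_eq_abs M, abs_of_nonneg hM0]; exact hgb z)
  refine ⟨fun t => ∫ x in a..t, g x, fun t ht => ?_⟩
  have hdiff : ∀ r s, (∫ x in a..s, g x) - ∫ x in a..r, g x = ∫ x in r..s, g x := fun r s =>
    intervalIntegral.integral_interval_sub_left (hgi a s) (hgi a r)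
  by_cases hd : RightDense S t
  · rw [hasDeltaDerivAt_iff_of_rightDense hd, hasDerivWithinAt_iff_isLittleO,
      Asymptotics.isLittleO_iff]
    intro ε hε
    have hc := (hf t ht).1 hd
    rw [ContinuousWithinAt, h.nhdsWithin_kappa ht] at hc
    obtain ⟨δ, hδ, H⟩ := Metric.eventually_nhds_iff.1 (eventually_nhdsWithin_iff.1
      (Eventually.and (p := fun s => s ∈ kappa S) (h.kappa_mem_nhdsWithin ht)
        (Metric.tendsto_nhds.1 hc ε hε)))
    rw [eventually_nhdsWithin_iff]
    filter_upwards [Metric.ball_mem_nhds t hδ] with s hs hsS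
    have hest : ∀ x ∈ uIoc t s, ‖g x - f t‖ ≤ ε := by
      intro x hx
      -- The smaller endpoint lies in `S`, so the last scale point before `x` stays between `t` and
      -- `s`, whichever side `s` is on.
      have hmin : min t s ∈ S := by
        rcases min_choice t s with e | e <;> rw [e]
        exacts [ht.1, hsS]
      have h1 := h.le_lastBefore hmin hx.1.le
      have h2 := h.lastBefore_le ((h.subset hmin).1.trans hx.1.le)
      have h3 : dist (lastBefore S a x) t < δ := by
        refine lt_of_le_of_lt ?_ (Metric.mem_ball.1 hs)
        have h4 : lastBefore S a x ∈ uIcc t s := ⟨h1, h2.trans hx.2⟩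
        rw [Real.dist_eq, Real.dist_eq]
        exact abs_sub_left_of_mem_uIcc h4
      obtain ⟨h5, h6⟩ := H h3 (h.lastBefore_mem x)
      simp only [hg, indicator_of_mem h5]
      exact h6.le
    have hint := intervalIntegral.norm_integral_le_of_norm_le_const hest
    rw [intervalIntegral.integral_sub (hgi t s) intervalIntegrable_const,
      intervalIntegral.integral_const, ← hdiff t s] at hint
    exact hint
  · refine h.hasDeltaDerivAt_of_not_rightDense ht.1 hd
      (intervalIntegral.continuous_primitive hgi a).continuousWithinAt ?_
    have hσ : ∫ x in t..sigma S t, g x = graininess S t * f t := by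
      rw [intervalIntegral.integral_congr_Ioo_of_le (g := fun _ => f t) (h.le_sigma ht.1)]
      · rw [intervalIntegral.integral_const, smul_eq_mul, graininess]
      · intro x hx
        simp only [hg, h.lastBefore_eq ht.1 hx.1.le hx.2, indicator_of_mem ht]
    have := hdiff t (sigma S t)
    linarith

end IsCompactScale

/-! ### Closure properties of rd-continuity -/

namespace RdContinuous

theorem comp₂ {u v : ℝ → ℝ} (hu : RdContinuous S u) (hv : RdContinuous S v) {Ψ : ℝ × ℝ → ℝ}
    (hΨ : Continuous Ψ) : RdContinuous S fun t => Ψ (u t, v t) := by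
  intro t ht
  refine ⟨fun hd => ?_, fun hl => ?_⟩
  · exact hΨ.continuousAt.comp_continuousWithinAt (((hu t ht).1 hd).prodMk ((hv t ht).1 hd))
  · obtain ⟨l, hl₁⟩ := (hu t ht).2 hl
    obtain ⟨m, hm⟩ := (hv t ht).2 hl
    exact ⟨Ψ (l, m), (hΨ.tendsto (l, m)).comp (hl₁.prodMk_nhds hm)⟩

theorem congr {u v : ℝ → ℝ} (hu : RdContinuous S u) (huv : ∀ t ∈ kappa S, v t = u t) :
    RdContinuous S v := by
  intro t ht
  refine ⟨fun hd => ((hu t ht).1 hd).congr huv (huv t ht), fun hl => ?_⟩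
  obtain ⟨l, hl₁⟩ := (hu t ht).2 hl
  refine ⟨l, hl₁.congr' ?_⟩
  filter_upwards [self_mem_nhdsWithin] with s hs using (huv s hs.1).symm

end RdContinuous

theorem rdContinuous_of_continuousOn {f : ℝ → ℝ} (hf : ContinuousOn f S) : RdContinuous S f :=
  fun t ht => ⟨fun _ => (hf t ht.1).mono kappa_subset, fun _ => ⟨f t,
    (hf t ht.1).mono_left (nhdsWithin_mono _ (inter_subset_left.trans kappa_subset))⟩⟩

/-- From the left, `s ≤ σ(s) ≤ t` gives the limit `f t`, which may differ from `f (σ t)` when `t` is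
right-scattered. -/
theorem IsCompactScale.rdContinuous_comp_sigma (h : IsCompactScale S a b) {f : ℝ → ℝ}
    (hf : ContinuousOn f S) : RdContinuous S fun t => f (sigma S t) := by
  intro t ht
  refine ⟨fun hd => ?_, fun _ => ⟨f t, ?_⟩⟩
  · have hσ : Tendsto (sigma S) (𝓝[kappa S] t) (𝓝[S] t) := by
      refine tendsto_nhdsWithin_iff.2 ⟨(h.tendsto_sigma_of_rightDense ht.1 hd).mono_left
        (nhdsWithin_mono _ kappa_subset), ?_⟩
      filter_upwards [self_mem_nhdsWithin] with s hs using h.sigma_mem hs.1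
    have := (hf t ht.1).tendsto.comp hσ
    rw [ContinuousWithinAt, show sigma S t = t from hd]
    exact this
  · refine (hf t ht.1).tendsto.comp (tendsto_nhdsWithin_iff.2 ⟨?_, ?_⟩)
    · rw [h.kappa_inter_Iio ht.1]
      exact h.tendsto_sigma_left ht.1
    · filter_upwards [self_mem_nhdsWithin] with s hs using h.sigma_mem hs.1.1

theorem IsCompactScale.rdContinuous_graininess (h : IsCompactScale S a b) :
    RdContinuous S (graininess S) :=
  (h.rdContinuous_comp_sigma continuousOn_id).comp₂ (rdContinuous_of_continuousOn continuousOn_id)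
    continuous_sub

/-! ### The chain rule -/

/-- The mean value of `φ` over the segment from `x` to `x + m`. -/
noncomputable def segmentMean (φ : ℝ → ℝ) (x m : ℝ) : ℝ := ∫ h in (0 : ℝ)..1, φ (x + h * m)

/-- Substitution in the mean; this is what makes the chain rule exact across a jump. -/
theorem primitive_add {φ : ℝ → ℝ} (hφ : Continuous φ) (x m : ℝ) :
    primitive φ (x + m) = primitive φ x + m * segmentMean φ x m := by
  have h1 := intervalIntegral.smul_integral_comp_add_mul (a := 0) (b := 1) φ m x
  have h2 := intervalIntegral.integral_add_adjacent_intervals (hφ.intervalIntegrable 0 x)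
    (hφ.intervalIntegrable x (x + m)) (μ := MeasureTheory.volume)
  simp only [mul_zero, add_zero, mul_one, smul_eq_mul] at h1
  simp only [primitive, segmentMean, mul_comm _ m]
  rw [h1, h2]

theorem continuous_segmentMean {φ : ℝ → ℝ} (hφ : Continuous φ) :
    Continuous fun p : ℝ × ℝ => segmentMean φ p.1 p.2 :=
  intervalIntegral.continuous_parametric_intervalIntegral_of_continuous'
    (f := fun (p : ℝ × ℝ) (h : ℝ) => φ (p.1 + h * p.2)) (by fun_prop) 0 1

theorem segmentMean_pos {φ : ℝ → ℝ} (hφ : Continuous φ) (hpos : ∀ x, 0 < φ x) (x m : ℝ) :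
    0 < segmentMean φ x m :=
  intervalIntegral.intervalIntegral_pos_of_pos
    (Continuous.intervalIntegrable (by fun_prop) 0 1) (fun _ => hpos _) one_pos

@[simp]
theorem segmentMean_zero (φ : ℝ → ℝ) (x : ℝ) : segmentMean φ x 0 = φ x := by
  simp [segmentMean]

theorem primitive_zero (φ : ℝ → ℝ) : primitive φ 0 = 0 := by simp [primitive]

theorem hasDerivAt_primitive {φ : ℝ → ℝ} (hφ : Continuous φ) (x : ℝ) :
    HasDerivAt (primitive φ) (φ x) x :=
  hφ.integral_hasStrictDerivAt 0 x |>.hasDerivAt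

theorem continuous_primitive {φ : ℝ → ℝ} (hφ : Continuous φ) : Continuous (primitive φ) :=
  continuous_iff_continuousAt.2 fun x => (hasDerivAt_primitive hφ x).continuousAt

theorem strictMono_primitive {φ : ℝ → ℝ} (hφ : Continuous φ) (hpos : ∀ x, 0 < φ x) :
    StrictMono (primitive φ) :=
  strictMono_of_hasDerivAt_pos (hasDerivAt_primitive hφ) hpos

theorem IsCompactScale.hasDeltaDerivAt_primitive_comp (h : IsCompactScale S a b) {φ : ℝ → ℝ}
    (hφ : Continuous φ) {y : ℝ → ℝ} {d t : ℝ} (ht : t ∈ S) (hy : HasDeltaDerivAt S y d t) :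
    HasDeltaDerivAt S (fun s => primitive φ (y s))
      (segmentMean φ (y t) (graininess S t * d) * d) t := by
  by_cases hd : RightDense S t
  · have hμ : graininess S t = 0 := sub_eq_zero.2 hd
    rw [hμ, zero_mul, segmentMean_zero]
    rw [hasDeltaDerivAt_iff_of_rightDense hd] at hy ⊢
    exact (hasDerivAt_primitive hφ (y t)).comp_hasDerivWithinAt t hy
  · refine h.hasDeltaDerivAt_of_not_rightDense ht hd ?_ ?_
    · exact (continuous_primitive hφ).continuousAt.comp_continuousWithinAt
        (hy.continuousWithinAt ht)
    · rw [hy.sigma_eq ht, primitive_add hφ]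
      ring

/-- The `Δ`-derivative of `G ∘ y`, as given by the chain rule. -/
noncomputable def chainDeriv (S : Set ℝ) (φ y : ℝ → ℝ) (t : ℝ) : ℝ :=
  segmentMean φ (y t) (graininess S t * deltaDeriv S y t) * deltaDeriv S y t

theorem integrand_eq (S : Set ℝ) (φ : ℝ → ℝ) (α : ℝ) (y : ℝ → ℝ) :
    integrand S φ α y = fun t => chainDeriv S φ y t ^ α := by
  funext t
  simp only [integrand, chainDeriv, segmentMean, mul_assoc]

theorem IsCompactScale.isAntiderivative_primitive_comp (h : IsCompactScale S a b) {φ : ℝ → ℝ}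
    (hφ : Continuous φ) {y : ℝ → ℝ} (hy : C1rd S y) :
    IsAntiderivative S (fun s => primitive φ (y s)) (chainDeriv S φ y) := fun t ht =>
  h.hasDeltaDerivAt_primitive_comp hφ ht.1 (hasDeltaDerivAt_deltaDeriv (hy.1 t ht))

theorem IsCompactScale.rdContinuous_chainDeriv (h : IsCompactScale S a b) {φ : ℝ → ℝ}
    (hφ : Continuous φ) {y : ℝ → ℝ} (hy : C1rd S y) : RdContinuous S (chainDeriv S φ y) :=
  ((rdContinuous_of_continuousOn (h.continuousOn_of_hasDeltaDerivAt hy.1)).comp₂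
    (h.rdContinuous_graininess.comp₂ hy.2 continuous_mul) (continuous_segmentMean hφ)).comp₂
    hy.2 continuous_mul

/-- Positivity of `α` matters: a left-sided limit of `chainDeriv` may be `0`, where a negative power
has no finite limit. -/
theorem IsCompactScale.rdContinuous_integrand (h : IsCompactScale S a b) {φ : ℝ → ℝ}
    (hφ : Continuous φ) {y : ℝ → ℝ} (hy : C1rd S y) {α : ℝ} (hα : 0 < α) :
    RdContinuous S (integrand S φ α y) := by
  have hc := h.rdContinuous_chainDeriv hφ hy
  rw [integrand_eq]
  exact hc.comp₂ hc (Ψ := fun p => p.1 ^ α) ((Real.continuous_rpow_const hα.le).comp continuous_fst)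

/-! ### The tangent line inequality -/

/-- Bernoulli's inequality; for `α < 0` it is applied to `x⁻¹` with exponent `1 - α > 1` and
multiplied by `x`. -/
theorem tangent_lt_rpow {α : ℝ} (hα : α < 0 ∨ 1 < α) {x : ℝ} (hx : 0 < x) (hx1 : x ≠ 1) :
    1 + α * (x - 1) < x ^ α := by
  have hx1' : x - 1 ≠ 0 := sub_ne_zero.2 hx1
  rcases hα with hα | hα
  · have hs : x⁻¹ - 1 ≠ 0 := sub_ne_zero.2 fun H => hx1 (inv_eq_one.1 H)
    have h1 := one_add_mul_self_lt_rpow_one_add (s := x⁻¹ - 1)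
      (by linarith [inv_pos.2 hx]) hs (p := 1 - α) (by linarith)
    rw [add_sub_cancel, Real.inv_rpow hx.le, Real.rpow_sub hx, Real.rpow_one, inv_div] at h1
    have h2 := mul_lt_mul_of_pos_left h1 hx
    rw [mul_div_cancel₀ _ hx.ne'] at h2
    refine lt_of_eq_of_lt ?_ h2
    field_simp
    ring
  · have h1 := one_add_mul_self_lt_rpow_one_add (s := x - 1) (by linarith) hx1' hα
    rwa [add_sub_cancel] at h1

theorem rpow_lt_tangent {α : ℝ} (hα0 : 0 < α) (hα1 : α < 1) {x : ℝ} (hx : 0 < x) (hx1 : x ≠ 1) :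
    x ^ α < 1 + α * (x - 1) := by
  have h1 := rpow_one_add_lt_one_add_mul_self (s := x - 1) (by linarith) (sub_ne_zero.2 hx1)
    hα0 hα1
  rwa [add_sub_cancel] at h1

/-- Homogeneity moves the tangent point from `C` to `1`. -/
theorem tangent_scale {α C u : ℝ} (hC : 0 < C) (hu : 0 < u) :
    u ^ α - C ^ α - α * C ^ α / C * (u - C) =
      C ^ α * ((u / C) ^ α - (1 + α * (u / C - 1))) := by
  rw [Real.div_rpow hu.le hC.le]
  have : C ^ α ≠ 0 := (Real.rpow_pos_of_pos hC α).ne'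
  field_simp
  ring

/-- Minimality of the constant velocity, with its equality case; `e` is the sign that makes
`u ↦ e * u ^ α` convex. -/
theorem IsCompactScale.integral_rpow_compare (h : IsCompactScale S a b) {u U H : ℝ → ℝ}
    {α C D e : ℝ} (hU : IsAntiderivative S U u) (hH : IsAntiderivative S H fun t => u t ^ α)
    (htan : ∀ t ∈ kappa S, u t ≠ C → 0 < e * (u t ^ α - C ^ α - D * (u t - C)))
    (hUab : U b - U a = C * (b - a)) :
    0 ≤ e * (H b - H a - (b - a) * C ^ α) ∧
      (H b - H a = (b - a) * C ^ α → ∀ t ∈ S, U t - U a = C * (t - a)) := by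
  -- `K` integrates `e` times the deviation of `u ^ α` from the line of slope `D` through `(C, C ^
  -- α)`. By `hUab` the linear term contributes nothing over `[a, b]`.
  have hK : IsAntiderivative S
      (fun s => (e * H s + (-(e * D)) * U s) + ((e * D * C - e * C ^ α) * s + 0))
      (fun t => (e * u t ^ α + (-(e * D)) * u t) + (e * D * C - e * C ^ α)) := fun t ht =>
    (((hH t ht).const_mul e).add ((hU t ht).const_mul (-(e * D)))).add
      (hasDeltaDerivAt_linear _ _ t)
  set K : ℝ → ℝ := fun s => (e * H s + (-(e * D)) * U s) + ((e * D * C - e * C ^ α) * s + 0)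
    with hKdef
  have hk : ∀ t ∈ kappa S, 0 ≤ (e * u t ^ α + (-(e * D)) * u t) + (e * D * C - e * C ^ α) := by
    intro t ht
    by_cases hne : u t = C
    · rw [hne]; exact le_of_eq (by ring)
    · exact (htan t ht hne).le.trans_eq (by ring)
  have hmono := h.monotoneOn_of_deltaDeriv_nonneg hK hk
  have hKab : K b - K a = e * (H b - H a - (b - a) * C ^ α) := by
    simp only [hKdef]
    linear_combination (-(e * D)) * hUab
  refine ⟨hKab ▸ sub_nonneg.2 (hmono h.left_mem h.right_mem h.lt.le), fun heq => ?_⟩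
  rw [heq, sub_self, mul_zero, sub_eq_zero] at hKab
  -- A monotone function with equal end values is constant; its Δ-derivative vanishes, and
  -- strictness off `C` then gives `u = C`.
  have hconst : ∀ t ∈ S, K t = K a := fun t ht => le_antisymm
    ((hmono ht h.right_mem (h.subset ht).2).trans_eq hKab) (hmono h.left_mem ht (h.subset ht).1)
  have hu : ∀ t ∈ kappa S, u t = C := by
    intro t ht
    have hzero : HasDeltaDerivAt S K 0 t := by
      intro ε hε
      refine ⟨1, one_pos, fun s hs _ => ?_⟩
      rw [hconst s hs, hconst _ (h.sigma_mem ht.1), sub_self, zero_mul, sub_self, abs_zero]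
      positivity
    have hk0 := h.hasDeltaDerivAt_unique ht (hK t ht) hzero
    by_contra hne
    exact (htan t ht hne).ne' (by linarith)
  intro t ht
  have := h.sub_eq_of_isAntiderivative hU (fun t _ => hasDeltaDerivAt_linear C 0 t) hu
    h.left_mem ht
  linarith

/-! ### The extremal -/

section Extremal

variable {φ : ℝ → ℝ} {B : ℝ}

theorem extremalConst_eq (φ : ℝ → ℝ) (a b B : ℝ) :
    extremalConst φ a b B = primitive φ B / (b - a) := rfl

theorem extremalConst_mul (hab : a < b) : extremalConst φ a b B * (b - a) = primitive φ B := by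
  rw [extremalConst_eq, div_mul_cancel₀ _ (sub_pos.2 hab).ne']

theorem extremalConst_pos (hφ : Continuous φ) (hpos : ∀ x, 0 < φ x) (hB : 0 < B) (hab : a < b) :
    0 < extremalConst φ a b B :=
  div_pos ((primitive_zero φ).symm.trans_lt (strictMono_primitive hφ hpos hB)) (sub_pos.2 hab)

/-- `G` need not map onto `[0, ∞)`; the intermediate value theorem covers `[0, G(B)]`, which is all
that is needed. -/
theorem primitive_primitiveInv (hφ : Continuous φ) (hB : 0 ≤ B) {c : ℝ}
    (hc : c ∈ Icc 0 (primitive φ B)) : primitive φ (primitiveInv φ c) = c := by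
  have hivt := intermediate_value_Icc hB (continuous_primitive hφ).continuousOn
  rw [primitive_zero] at hivt
  obtain ⟨x, hx, hxc⟩ := hivt hc
  exact Function.invFunOn_eq ⟨x, hx.1, hxc⟩

theorem primitive_extremal (hφ : Continuous φ) (hpos : ∀ x, 0 < φ x) (hB : 0 < B) (hab : a < b)
    {t : ℝ} (ht : t ∈ Icc a b) :
    primitive φ (extremal φ a b B t) = extremalConst φ a b B * (t - a) := by
  have hC := extremalConst_pos hφ hpos hB hab
  refine primitive_primitiveInv hφ hB.le ⟨mul_nonneg hC.le (sub_nonneg.2 ht.1), ?_⟩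
  rw [← extremalConst_mul hab]
  gcongr
  exact ht.2

/-- `G` is an embedding, so continuity can be tested after composing with `G`, where the function is
affine. -/
theorem continuousOn_extremal (hφ : Continuous φ) (hpos : ∀ x, 0 < φ x) (hB : 0 < B)
    (hab : a < b) : ContinuousOn (extremal φ a b B) (Icc a b) := by
  have hemb := (strictMono_primitive hφ hpos).isEmbedding_of_ordConnected
    (isPreconnected_range (continuous_primitive hφ)).ordConnected
  rw [hemb.isInducing.continuousOn_iff]
  refine ContinuousOn.congr (f := fun t => extremalConst φ a b B * (t - a)) (by fun_prop) ?_
  exact fun t ht => primitive_extremal hφ hpos hB hab ht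

/-- One difference quotient serves both cases of the Δ-derivative: `s → t` at right-dense points, `s
= σ(t)` at right-scattered ones. -/
theorem extremal_sub (hφ : Continuous φ) (hpos : ∀ x, 0 < φ x) (hB : 0 < B) (hab : a < b)
    {s t : ℝ} (hs : s ∈ Icc a b) (ht : t ∈ Icc a b) :
    extremal φ a b B s - extremal φ a b B t = (s - t) * (extremalConst φ a b B /
      segmentMean φ (extremal φ a b B t) (extremal φ a b B s - extremal φ a b B t)) := by
  have h1 := primitive_add hφ (extremal φ a b B t) (extremal φ a b B s - extremal φ a b B t)
  rw [add_sub_cancel, primitive_extremal hφ hpos hB hab hs,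
    primitive_extremal hφ hpos hB hab ht] at h1
  rw [mul_div_assoc', eq_div_iff (segmentMean_pos hφ hpos _ _).ne']
  linarith

namespace IsCompactScale

theorem hasDeltaDerivAt_extremal (h : IsCompactScale S a b) (hφ : Continuous φ)
    (hpos : ∀ x, 0 < φ x) (hB : 0 < B) {t : ℝ} (ht : t ∈ S) :
    HasDeltaDerivAt S (extremal φ a b B) (extremalConst φ a b B /
      segmentMean φ (extremal φ a b B t)
        (extremal φ a b B (sigma S t) - extremal φ a b B t)) t := by
  have hcont := (continuousOn_extremal hφ hpos hB h.lt).mono h.subset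
  by_cases hd : RightDense S t
  · rw [hasDeltaDerivAt_iff_of_rightDense hd, show sigma S t = t from hd,
      hasDerivWithinAt_iff_tendsto_slope]
    have hlim : Tendsto (fun s => extremalConst φ a b B / segmentMean φ (extremal φ a b B t)
        (extremal φ a b B s - extremal φ a b B t)) (𝓝[S] t)
        (𝓝 (extremalConst φ a b B / segmentMean φ (extremal φ a b B t)
          (extremal φ a b B t - extremal φ a b B t))) := by
      refine tendsto_const_nhds.div ?_ (segmentMean_pos hφ hpos _ _).ne'
      exact ((continuous_segmentMean hφ).tendsto (extremal φ a b B t,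
        extremal φ a b B t - extremal φ a b B t)).comp
        (tendsto_const_nhds.prodMk_nhds ((hcont t ht).tendsto.sub tendsto_const_nhds))
    refine (hlim.mono_left (nhdsWithin_mono _ sdiff_subset)).congr' ?_
    filter_upwards [self_mem_nhdsWithin] with s hs
    have hne : s - t ≠ 0 := sub_ne_zero.2 hs.2
    rw [slope_def_field, eq_div_iff hne, mul_comm]
    exact (extremal_sub hφ hpos hB h.lt (h.subset hs.1) (h.subset ht)).symm
  · refine h.hasDeltaDerivAt_of_not_rightDense ht hd (hcont t ht) ?_
    have := extremal_sub hφ hpos hB h.lt (h.subset (h.sigma_mem ht)) (h.subset ht)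
    rw [graininess]
    linarith

theorem deltaDeriv_extremal (h : IsCompactScale S a b) (hφ : Continuous φ)
    (hpos : ∀ x, 0 < φ x) (hB : 0 < B) {t : ℝ} (ht : t ∈ kappa S) :
    deltaDeriv S (extremal φ a b B) t = extremalConst φ a b B /
      segmentMean φ (extremal φ a b B t)
        (extremal φ a b B (sigma S t) - extremal φ a b B t) :=
  h.deltaDeriv_eq ht (h.hasDeltaDerivAt_extremal hφ hpos hB ht.1)

theorem chainDeriv_extremal (h : IsCompactScale S a b) (hφ : Continuous φ)
    (hpos : ∀ x, 0 < φ x) (hB : 0 < B) {t : ℝ} (ht : t ∈ kappa S) :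
    chainDeriv S φ (extremal φ a b B) t = extremalConst φ a b B := by
  have hsub := extremal_sub hφ hpos hB h.lt (h.subset (h.sigma_mem ht.1)) (h.subset ht.1)
  rw [chainDeriv, h.deltaDeriv_extremal hφ hpos hB ht, graininess, ← hsub,
    mul_div_cancel₀ _ (segmentMean_pos hφ hpos _ _).ne']

theorem c1rd_extremal (h : IsCompactScale S a b) (hφ : Continuous φ) (hpos : ∀ x, 0 < φ x)
    (hB : 0 < B) : C1rd S (extremal φ a b B) := by
  have hcont := (continuousOn_extremal hφ hpos hB h.lt).mono h.subset
  refine ⟨fun t ht => ⟨_, h.hasDeltaDerivAt_extremal hφ hpos hB ht.1⟩, ?_⟩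
  have hΨ : Continuous fun p : ℝ × ℝ =>
      extremalConst φ a b B / segmentMean φ p.1 (p.2 - p.1) :=
    continuous_const.div ((continuous_segmentMean hφ).comp
      (continuous_fst.prodMk (continuous_snd.sub continuous_fst)))
      fun _ => (segmentMean_pos hφ hpos _ _).ne'
  exact ((rdContinuous_of_continuousOn hcont).comp₂ (h.rdContinuous_comp_sigma hcont) hΨ).congr
    fun t ht => h.deltaDeriv_extremal hφ hpos hB ht

theorem isAntiderivative_integrand_extremal (h : IsCompactScale S a b) (hφ : Continuous φ)
    (hpos : ∀ x, 0 < φ x) (hB : 0 < B) (α : ℝ) :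
    IsAntiderivative S (fun t => extremalConst φ a b B ^ α * t + 0)
      (integrand S φ α (extremal φ a b B)) := by
  intro t ht
  rw [integrand_eq]
  simp only [h.chainDeriv_extremal hφ hpos hB ht]
  exact hasDeltaDerivAt_linear _ _ t

end IsCompactScale

/-! ### The value at the extremal and comparison with competitors -/

theorem extremal_mem_functionalDomain {T : Set ℝ} (h : IsCompactScale (interval T a b) a b)
    (hφ : Continuous φ) (hpos : ∀ x, 0 < φ x) (hB : 0 < B) (α : ℝ) :
    extremal φ a b B ∈ functionalDomain T a b B φ α := by
  have hinj := (strictMono_primitive hφ hpos).injective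
  refine ⟨⟨h.c1rd_extremal hφ hpos hB, fun t ht => ?_, hinj ?_, hinj ?_⟩,
    _, h.isAntiderivative_integrand_extremal hφ hpos hB α⟩
  · rw [h.deltaDeriv_extremal hφ hpos hB ht]
    exact div_pos (extremalConst_pos hφ hpos hB h.lt) (segmentMean_pos hφ hpos _ _)
  · rw [primitive_extremal hφ hpos hB h.lt (left_mem_Icc.2 h.lt.le), sub_self, mul_zero,
      primitive_zero]
  · rw [primitive_extremal hφ hpos hB h.lt (right_mem_Icc.2 h.lt.le), extremalConst_mul h.lt]

theorem functional_extremal {T : Set ℝ} (h : IsCompactScale (interval T a b) a b)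
    (hφ : Continuous φ) (hpos : ∀ x, 0 < φ x) (hB : 0 < B) (α : ℝ) :
    functional T a b φ α (extremal φ a b B) = (b - a) * extremalConst φ a b B ^ α := by
  rw [functional, h.deltaIntegral_eq (h.isAntiderivative_integrand_extremal hφ hpos hB α)
    h.left_mem h.right_mem]
  ring

/-- Comparison of an arbitrary competitor with the extremal, with the equality case. -/
theorem functional_compare {T : Set ℝ} (h : IsCompactScale (interval T a b) a b)
    (hφ : Continuous φ) (hpos : ∀ x, 0 < φ x) (hB : 0 < B) {α e : ℝ}
    (htan : ∀ x : ℝ, 0 < x → x ≠ 1 → 0 < e * (x ^ α - (1 + α * (x - 1)))) {y : ℝ → ℝ}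
    (hy : y ∈ functionalDomain T a b B φ α) :
    0 ≤ e * (functional T a b φ α y - (b - a) * extremalConst φ a b B ^ α) ∧
      (functional T a b φ α y = (b - a) * extremalConst φ a b B ^ α →
        EqOn y (extremal φ a b B) (interval T a b)) := by
  obtain ⟨⟨hC1, hder, hya, hyb⟩, H, hH⟩ := hy
  have hC := extremalConst_pos hφ hpos hB h.lt
  have hU := h.isAntiderivative_primitive_comp hφ hC1
  rw [functional, h.deltaIntegral_eq hH h.left_mem h.right_mem]
  rw [integrand_eq] at hH
  have hscaled : ∀ t ∈ kappa (interval T a b), chainDeriv (interval T a b) φ y t ≠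
      extremalConst φ a b B → 0 < e * (chainDeriv (interval T a b) φ y t ^ α -
        extremalConst φ a b B ^ α - α * extremalConst φ a b B ^ α / extremalConst φ a b B *
          (chainDeriv (interval T a b) φ y t - extremalConst φ a b B)) := by
    intro t ht hne
    have hu : 0 < chainDeriv (interval T a b) φ y t :=
      mul_pos (segmentMean_pos hφ hpos _ _) (hder t ht)
    -- The slope is `D = α C^α / C`, that of the tangent to `u ↦ u^α` at `C`.
    rw [tangent_scale hC hu, mul_left_comm]
    refine mul_pos (Real.rpow_pos_of_pos hC α) (htan _ (div_pos hu hC) ?_)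
    rwa [Ne, div_eq_one_iff_eq hC.ne']
  have htotal : primitive φ (y b) - primitive φ (y a) = extremalConst φ a b B * (b - a) := by
    rw [hya, hyb, primitive_zero, sub_zero, extremalConst_mul h.lt]
  obtain ⟨h1, h2⟩ := h.integral_rpow_compare hU hH hscaled htotal
  refine ⟨h1, fun heq t ht => (strictMono_primitive hφ hpos).injective ?_⟩
  have := h2 heq t ht
  rw [hya, primitive_zero, sub_zero] at this
  rw [this, primitive_extremal hφ hpos hB h.lt (h.subset ht)]

end Extremal

end TimeScale

theorem mainTheorem8 (T : Set ℝ) (hT : TimeScale.IsTimeScale T) (a b : ℝ)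
    (ha : a ∈ T) (hb : b ∈ T) (hab : a < b)
    (φ : ℝ → ℝ) (hφ : Continuous φ) (hφpos : ∀ x, 0 < φ x)
    (B : ℝ) (hB : 0 < B) (α : ℝ) (hα0 : α ≠ 0) (hα1 : α ≠ 1) :
    -- where the functional is defined
    (∀ y, TimeScale.Admissible T a b B y →
      (0 < α ∨ TimeScale.RdContinuous (TimeScale.interval T a b)
          (TimeScale.integrand (TimeScale.interval T a b) φ α y)) →
      y ∈ TimeScale.functionalDomain T a b B φ α) ∧
    -- (i) the minimum
    (α < 0 ∨ 1 < α →
      TimeScale.extremal φ a b B ∈ TimeScale.functionalDomain T a b B φ α ∧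
      IsMinOn (TimeScale.functional T a b φ α) (TimeScale.functionalDomain T a b B φ α)
        (TimeScale.extremal φ a b B) ∧
      TimeScale.functional T a b φ α (TimeScale.extremal φ a b B)
        = (b - a) * TimeScale.extremalConst φ a b B ^ α ∧
      ∀ y ∈ TimeScale.functionalDomain T a b B φ α,
        TimeScale.functional T a b φ α y = (b - a) * TimeScale.extremalConst φ a b B ^ α →
        Set.EqOn y (TimeScale.extremal φ a b B) (TimeScale.interval T a b)) ∧
    -- (ii) the maximum
    (0 < α ∧ α < 1 →
      TimeScale.extremal φ a b B ∈ TimeScale.functionalDomain T a b B φ α ∧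
      IsMaxOn (TimeScale.functional T a b φ α) (TimeScale.functionalDomain T a b B φ α)
        (TimeScale.extremal φ a b B) ∧
      TimeScale.functional T a b φ α (TimeScale.extremal φ a b B)
        = (b - a) * TimeScale.extremalConst φ a b B ^ α ∧
      ∀ y ∈ TimeScale.functionalDomain T a b B φ α,
        TimeScale.functional T a b φ α y = (b - a) * TimeScale.extremalConst φ a b B ^ α →
        Set.EqOn y (TimeScale.extremal φ a b B) (TimeScale.interval T a b)) := by
  have h := TimeScale.isCompactScale_interval hT ha hb hab
  refine ⟨fun y hy hor => ⟨hy, h.deltaIntegrable_of_rdContinuous ?_⟩, fun hα => ?_, fun hα => ?_⟩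
  · rcases hor with hα | hrd
    · exact h.rdContinuous_integrand hφ hy.1 hα
    · exact hrd
  -- Convex case, sign `e = 1`; the concave case below uses `e = -1`.
  · have htan : ∀ x : ℝ, 0 < x → x ≠ 1 → 0 < 1 * (x ^ α - (1 + α * (x - 1))) :=
      fun x hx hx1 => by linarith [TimeScale.tangent_lt_rpow hα hx hx1]
    have hmin := TimeScale.functional_extremal h hφ hφpos hB α
    refine ⟨TimeScale.extremal_mem_functionalDomain h hφ hφpos hB α, fun y hy => ?_, hmin,
      fun y hy => (TimeScale.functional_compare h hφ hφpos hB htan hy).2⟩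
    have := (TimeScale.functional_compare h hφ hφpos hB htan hy).1
    rw [mem_ofPred_eq]
    linarith
  · have htan : ∀ x : ℝ, 0 < x → x ≠ 1 → 0 < -1 * (x ^ α - (1 + α * (x - 1))) :=
      fun x hx hx1 => by linarith [TimeScale.rpow_lt_tangent hα.1 hα.2 hx hx1]
    have hmax := TimeScale.functional_extremal h hφ hφpos hB α
    refine ⟨TimeScale.extremal_mem_functionalDomain h hφ hφpos hB α, fun y hy => ?_, hmax,
      fun y hy => (TimeScale.functional_compare h hφ hφpos hB htan hy).2⟩
    have := (TimeScale.functional_compare h hφ hφpos hB htan hy).1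
    rw [mem_ofPred_eq]
    linarith
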